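/- **Conventions.** For a metric space $S$, $\mathcal P_S$ is the space of Radon probability measures on $S$ with the weak topology and $\mathcal P^{\mathrm{fin}}_S\subseteq\mathcal P_S$ the subspace of measures with finite support. For $\alpha,\beta\in\mathcal P_S$ with bounded support, $d^S_{W,\infty}(\alpha,\beta)=\inf_\mu\sup_{(x,x')\in\mathrm{supp}(\mu)}d_S(x,x')$, where $\mu$ ranges over the couplings of $\alpha$ and $\beta$. If $X\subseteq M$, then $\mathcal P_X$ is mapped to $\mathcal P_M$ by pushforward along the inclusion, and a function on $\mathcal P_M$ is restricted to $\mathcal P_X$ and $\mathcal P_X^{\mathrm{fin}}$ in this way. For topological spaces $A,B$ with (not necessarily continuous) functions $\varphi_A:A\to\mathbb R$, $\varphi_B:B\to\mathbb R$, a $\delta$-map $(A,\varphi_A)\to(B,\varphi_B)$ is a continuous map $\Phi:A\to B$ with $\varphi_B\circ\Phi\le\varphi_A+\delta$; a $\delta$-homotopy is a homotopy through $\delta$-maps; $(A,\varphi_A)$ and $(B,\varphi_B)$ are $\delta$-homotopy equivalent if there are $\delta$-maps $\Phi:A\to B$, $\Psi:B\to A$ such that $\Psi\circ\Phi$ and $\Phi\circ\Psi$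 are $2\delta$-homotopic to the identities; and $d_{HT}((A,\varphi_A),(B,\varphi_B))\in[0,\infty]$ is the infimum of all $\delta\ge0$ for which they are $\delta$-homotopy equivalent. $d_I$ is the interleaving distance of functors from $(\mathbb R,\le)$ to vector spaces, with values in $[0,\infty]$. $H_k$ is singular homology with coefficients in a fixed field. $d_H^M$ is the Hausdorff distance in $M$, with values in $[0,\infty]$. For $p\in[1,\infty]$ and $\alpha\in\mathcal P_M$ with bounded support let $\mathrm{rad}^M_p(\alpha)=\inf_{m\in M}F_{\alpha,p}(m)$, where $F_{\alpha,p}(m)=\left(\int d_M(z,m)^p\,\alpha(dz)\right)^{1/p}$ for $p<\infty$ and $F_{\alpha,\infty}(m)=\sup_{z\in\mathrm{supp}(\alpha)}d_M(z,m)$. For $X\subseteq M$ totally bounded, let $\check{\mathrm C}_p(X,M;\bullet)$ be the filtration $r\mapsto\{\alpha\in\mathcal P_X\mid\mathrm{rad}_p^M(\alpha)<r\}$, $r\in\mathbb R$, and $\check{\mathrm C}{}^{\mathrm{fin}}_p(X,M;\bullet)$ the filtration obtained in the same way from $\mathcal P_X^{\mathrm{fin}}$. **Theorem.** Let $M$ be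 a metric space and let $X,Y\subseteq M$ be totally bounded. (1) Let $C>0$ and let $\mathfrak i^M:\mathcal P_M\to\mathbb R$ satisfy $|\mathfrak i^M(\alpha)-\mathfrak i^M(\beta)|\le C\,d^M_{W,\infty}(\alpha,\beta)$ for all $\alpha,\beta\in\mathcal P_M$ with bounded support. Then $$d_{HT}\big((\mathcal P_X,\mathfrak i^M),(\mathcal P_Y,\mathfrak i^M)\big)\le C\,d_H^M(X,Y),\qquad d_{HT}\big((\mathcal P^{\mathrm{fin}}_X,\mathfrak i^M),(\mathcal P^{\mathrm{fin}}_Y,\mathfrak i^M)\big)\le C\,d_H^M(X,Y).$$ (2) For every $p\in[1,\infty]$ and every integer $k\ge0$, $$d_I\big(H_k\circ\check{\mathrm C}_p(X,M;\bullet),H_k\circ\check{\mathrm C}_p(Y,M;\bullet)\big)\le d_{HT}\big((\mathcal P_X,\mathrm{rad}_p^M),(\mathcal P_Y,\mathrm{rad}_p^M)\big)\le d_H^M(X,Y),$$ $$d_I\big(H_k\circ\check{\mathrm C}{}^{\mathrm{fin}}_p(X,M;\bullet),H_k\circ\check{\mathrm C}{}^{\mathrm{fin}}_p(Y,M;\bullet)\big)\le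 d_{HT}\big((\mathcal P^{\mathrm{fin}}_X,\mathrm{rad}_p^M),(\mathcal P^{\mathrm{fin}}_Y,\mathrm{rad}_p^M)\big)\le d_H^M(X,Y).$$ -/

import Mathlib

open MeasureTheory CategoryTheory
open scoped NNReal ENNReal Topology unitInterval

noncomputable section

namespace AmbientCech

universe u v w

section Measures

/-- The space `𝒫_S` of Radon probability measures on `S` (Borel probability measures that are inner
regular with respect to compact sets on all Borel sets), with the weak topology, i.e. the topology
of convergence against bounded continuous functions. -/
abbrev RadonProb (S : Type u) [MetricSpace S] [MeasurableSpace S] [BorelSpace S] : Type u :=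
  {μ : ProbabilityMeasure S // (μ : Measure S).InnerRegular}

variable {S : Type u} [MetricSpace S] [MeasurableSpace S] [BorelSpace S]

/-- The underlying Borel measure of a Radon probability measure. -/
abbrev RadonProb.toMeasure (α : RadonProb S) : Measure S := (α.1 : Measure S)

variable (S) in
/-- The subspace `𝒫^fin_S` of Radon probability measures with finite support. -/
abbrev FinRadonProb : Type u :=
  {α : RadonProb S // α.toMeasure.support.Finite}

/-- For `X ⊆ M`, a Radon probability measure on the metric space `X`, seen as a Radon probability
measure on `M` by pushing forward along the inclusion. -/
def RadonProb.incl (X : Set S) (α : RadonProb X) : RadonProb S :=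
  ⟨α.1.map (f := Subtype.val) measurable_subtype_coe.aemeasurable, by
    have : α.toMeasure.InnerRegular := α.2
    exact Measure.InnerRegular.map_of_continuous (μ := α.toMeasure) continuous_subtype_val⟩

/-- `π` is a coupling of `α` and `β`: a probability measure on the product whose marginals are
`α` and `β`. -/
def IsCoupling (α β : RadonProb S) (π : Measure (S × S)) : Prop :=
  IsProbabilityMeasure π ∧ π.map Prod.fst = α.toMeasure ∧ π.map Prod.snd = β.toMeasure

/-- The `∞`-Wasserstein distance
`inf_{π ∈ Cpl(α, β)} sup_{(x, x') ∈ supp π} d(x, x')`, with values in `[0, ∞]`. -/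
def wassersteinInf (α β : RadonProb S) : ℝ≥0∞ :=
  ⨅ (π : Measure (S × S)) (_ : IsCoupling α β π), ⨆ z ∈ π.support, edist z.1 z.2

/-- `𝔦` is `C`-Lipschitz for the `∞`-Wasserstein distance on the Radon probability measures with
bounded support, which is where the `∞`-Wasserstein distance is defined as a finite metric.
Values of `𝔦` at measures with unbounded support are irrelevant. -/
def LipschitzWassersteinInf (C : ℝ≥0) (𝔦 : RadonProb S → ℝ) : Prop :=
  ∀ α β : RadonProb S, Bornology.IsBounded α.toMeasure.support →
    Bornology.IsBounded β.toMeasure.support →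
      edist (𝔦 α) (𝔦 β) ≤ C * wassersteinInf α β

/-- The Fréchet function `F_{α,p}(m) = (∫ d(z,m)^p α(dz))^{1/p}` for `p < ∞`, and
`F_{α,∞}(m) = sup_{z ∈ supp α} d(z,m)`, with values in `[0, ∞]`. -/
def frechet (p : ℝ≥0∞) (α : RadonProb S) (m : S) : ℝ≥0∞ :=
  if p = ∞ then ⨆ z ∈ α.toMeasure.support, edist z m
  else (∫⁻ z, edist z m ^ p.toReal ∂α.toMeasure) ^ (1 / p.toReal)

/-- The `p`-radius of a measure in the ambient space `S`: the infimum over all `m` in `S` of the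
Fréchet function (a real number for measures with bounded support). -/
def radius (p : ℝ≥0∞) (α : RadonProb S) : ℝ :=
  (⨅ m : S, frechet p α m).toReal

/-- The restriction to `𝒫_X`, `X ⊆ M`, of a function on Radon probability measures on `M`. -/
def restr (X : Set S) (𝔦 : RadonProb S → ℝ) (α : RadonProb X) : ℝ :=
  𝔦 (α.incl X)

/-- The restriction to `𝒫^fin_X`, `X ⊆ M`, of a function on Radon probability measures on `M`. -/
def restrFin (X : Set S) (𝔦 : RadonProb S → ℝ) (α : FinRadonProb X) : ℝ :=
  restr X 𝔦 α.1

end Measures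

section HomotopyTypeDistance

variable {X : Type u} {Y : Type v} [TopologicalSpace X] [TopologicalSpace Y]

/-- `Φ` is a `δ`-map from `(X, φ)` to `(Y, ψ)`. -/
def IsDeltaMap (φ : X → ℝ) (ψ : Y → ℝ) (δ : ℝ≥0) (Φ : C(X, Y)) : Prop :=
  ∀ x, ψ (Φ x) ≤ φ x + δ

/-- `Φ₀` and `Φ₁` are `δ`-homotopic with respect to `(φ, ψ)`: there is a homotopy between them
through `δ`-maps. -/
def DeltaHomotopic (φ : X → ℝ) (ψ : Y → ℝ) (δ : ℝ≥0) (Φ₀ Φ₁ : C(X, Y)) : Prop :=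
  ∃ H : ContinuousMap.Homotopy Φ₀ Φ₁, ∀ (t : I) (x : X), ψ (H (t, x)) ≤ φ x + δ

/-- `(X, φ)` and `(Y, ψ)` are `δ`-homotopy equivalent. -/
def DeltaHomotopyEquivalent (φ : X → ℝ) (ψ : Y → ℝ) (δ : ℝ≥0) : Prop :=
  ∃ (Φ : C(X, Y)) (Ψ : C(Y, X)),
    IsDeltaMap φ ψ δ Φ ∧ IsDeltaMap ψ φ δ Ψ ∧
    DeltaHomotopic φ φ (2 * δ) (Ψ.comp Φ) (ContinuousMap.id X) ∧
    DeltaHomotopic ψ ψ (2 * δ) (Φ.comp Ψ) (ContinuousMap.id Y)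

/-- The homotopy type distance `d_HT((X, φ), (Y, ψ))`, with values in `[0, ∞]`. -/
def dHT (φ : X → ℝ) (ψ : Y → ℝ) : ℝ≥0∞ :=
  ⨅ (δ : ℝ≥0) (_ : DeltaHomotopyEquivalent φ ψ δ), (δ : ℝ≥0∞)

end HomotopyTypeDistance

section Interleaving

variable {𝒞 : Type v} [Category.{w} 𝒞]

/-- The translation `t ↦ t + δ` of the poset `ℝ`, as a functor. -/
@[simps]
def shift (δ : ℝ≥0) : ℝ ⥤ ℝ where
  obj t := t + δ
  map {s t} h := homOfLE (show s + δ ≤ t + δ by linarith [leOfHom h])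

/-- `P` and `Q` are `δ`-interleaved: there are natural transformations `F : P ⟶ Q^δ` and
`G : Q ⟶ P^δ` whose composites `P ⟶ P^{2δ}` and `Q ⟶ Q^{2δ}` are given by the structure maps. -/
def Interleaved (P Q : ℝ ⥤ 𝒞) (δ : ℝ≥0) : Prop :=
  ∃ (F : P ⟶ shift δ ⋙ Q) (G : Q ⟶ shift δ ⋙ P),
    (∀ t : ℝ, F.app t ≫ G.app ((shift δ).obj t) =
      P.map (homOfLE (show t ≤ (shift δ).obj ((shift δ).obj t) by
        simp only [shift_obj]; linarith [δ.coe_nonneg]))) ∧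
    (∀ t : ℝ, G.app t ≫ F.app ((shift δ).obj t) =
      Q.map (homOfLE (show t ≤ (shift δ).obj ((shift δ).obj t) by
        simp only [shift_obj]; linarith [δ.coe_nonneg])))

/-- The interleaving distance, with values in `[0, ∞]`. -/
def dI (P Q : ℝ ⥤ 𝒞) : ℝ≥0∞ :=
  ⨅ (δ : ℝ≥0) (_ : Interleaved P Q δ), (δ : ℝ≥0∞)

end Interleaving

section PersistentHomology

/-- The open sublevel set filtration `r ↦ {x | φ x < r}`, with inclusions as structure maps. -/
def sublevel {X : Type u} [TopologicalSpace X] (φ : X → ℝ) : ℝ ⥤ TopCat.{u} where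
  obj r := TopCat.of {x : X // φ x < r}
  map {r s} h := TopCat.ofHom
    { toFun := fun x => ⟨x.1, lt_of_lt_of_le x.2 (leOfHom h)⟩
      continuous_toFun := by fun_prop }

/-- Singular homology in degree `n` with coefficients in the field `F`. -/
def singularHomology (F : Type v) [Field F] (n : ℕ) :
    TopCat.{u} ⥤ ModuleCat.{max u v} F :=
  (AlgebraicTopology.singularHomologyFunctor.{u} (ModuleCat.{max u v} F) n).obj
    (ModuleCat.of F (ULift.{u} F))

variable {M : Type u} [MetricSpace M] [MeasurableSpace M] [BorelSpace M]

/-- The ambient `p`-Čech filtration `r ↦ {α ∈ 𝒫_X | rad_p^M(α) < r}` of `X ⊆ M`. (It is empty for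
`r ≤ 0`, since radii are nonnegative.) -/
def ambientCech (p : ℝ≥0∞) (X : Set M) : ℝ ⥤ TopCat.{u} :=
  sublevel (restr X (radius p))

/-- The ambient `p`-Čech filtration `r ↦ {α ∈ 𝒫^fin_X | rad_p^M(α) < r}` of `X ⊆ M` with finite
supports. -/
def ambientCechFin (p : ℝ≥0∞) (X : Set M) : ℝ ⥤ TopCat.{u} :=
  sublevel (restrFin X (radius p))

end PersistentHomology

end AmbientCech

end

open AmbientCech

set_option linter.unusedSectionVars false

namespace AmbientCech

/-! ### Finite quantization of measures and straight-line homotopies. -/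

section Quantization

/-! Fix `δ` above the Hausdorff distance. Total boundedness gives a finite partition of unity `w` on
`X` subordinate to `δ`-balls around points `p i` of `Y` (`exists_weights`). Replacing `α` by `∑ i,
(∫ w i dα) δ_{p i}` is weakly continuous, because only finitely many integrals of bounded continuous
functions enter. Sending the part of `α` with density `w i` to `p i` is a coupling that moves mass
by at most `δ` (`wassersteinInf_quantizeMeasure_le`), so this is a `Cδ`-map. Going to `Y` and back
is again a quantization, of radius `2δ` (`quantize_quantize`), and leaving a fraction of the mass in
place costs nothing; hence the straight line to the identity is a `2Cδ`-homotopy. All of this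
preserves finite supports.

For the Čech filtrations, Minkowski's inequality along a coupling shows that the radius is
`1`-Lipschitz (`lipschitzWassersteinInf_radius`). `δ`-maps and `2δ`-homotopies restrict to sublevel
sets, so homotopy invariance of homology turns a `δ`-homotopy equivalence into a `δ`-interleaving.
-/

instance innerRegular_dirac {S : Type*} [TopologicalSpace S] [T1Space S] [MeasurableSpace S]
    [BorelSpace S] (y : S) : (Measure.dirac y).InnerRegular := by
  refine ⟨fun U hU r hr => ?_⟩
  by_cases hy : y ∈ U
  · refine ⟨{y}, by simpa using hy, isCompact_singleton, ?_⟩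
    simpa [hy] using hr
  · simp [Measure.dirac_apply' _ hU, hy] at hr

variable {S : Type*} [MetricSpace S] [MeasurableSpace S] [BorelSpace S]
  {T : Type*} [MetricSpace T] [MeasurableSpace T] [BorelSpace T]
  {ι : Type*} [Fintype ι]

instance RadonProb.innerRegular_toMeasure (α : RadonProb S) : α.toMeasure.InnerRegular := α.2

lemma sum_lintegral_weight {w : ι → C(S, ℝ≥0)} (hw : ∀ x, ∑ i, w i x = 1) (μ : Measure S)
    (f : S → ℝ≥0∞) (hf : Measurable f) :
    ∑ i, ∫⁻ x, w i x * f x ∂μ = ∫⁻ x, f x ∂μ := by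
  rw [← lintegral_finsetSum' _ (fun i _ => by fun_prop)]
  refine lintegral_congr fun x => ?_
  rw [← Finset.sum_mul, ← ENNReal.ofNNReal_finsetSum, hw, ENNReal.coe_one, one_mul]

/-- The finitely supported measure `∑ i, (∫ w i dμ) δ_{p i}`. -/
noncomputable def quantizeMeasure (w : ι → C(S, ℝ≥0)) (p : ι → T) (μ : Measure S) : Measure T :=
  ∑ i, (∫⁻ x, w i x ∂μ) • Measure.dirac (p i)

lemma lintegral_quantizeMeasure (w : ι → C(S, ℝ≥0)) (p : ι → T) (μ : Measure S) (f : T → ℝ≥0∞) :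
    ∫⁻ y, f y ∂quantizeMeasure w p μ = ∑ i, (∫⁻ x, w i x ∂μ) * f (p i) := by
  simp [quantizeMeasure]

/-- Sending `α` to `∑ i, (∫ w i dα) δ_{p i}`, for a finite partition of unity `w`. -/
noncomputable def quantize (w : ι → C(S, ℝ≥0)) (hw : ∀ x, ∑ i, w i x = 1) (p : ι → T)
    (α : RadonProb S) : RadonProb T :=
  ⟨⟨quantizeMeasure w p α.toMeasure, ⟨by
    have := sum_lintegral_weight hw α.toMeasure 1 measurable_one
    simp only [Pi.one_apply, mul_one, lintegral_one, measure_univ] at this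
    simpa [quantizeMeasure] using this⟩⟩, by
    change (quantizeMeasure w p α.toMeasure).InnerRegular
    unfold quantizeMeasure
    infer_instance⟩

lemma toMeasure_quantize (w : ι → C(S, ℝ≥0)) (hw : ∀ x, ∑ i, w i x = 1) (p : ι → T)
    (α : RadonProb S) : (quantize w hw p α).toMeasure = quantizeMeasure w p α.toMeasure := rfl

lemma RadonProb.ext_toMeasure {α β : RadonProb S} (h : α.toMeasure = β.toMeasure) : α = β :=
  Subtype.ext (Subtype.ext h)

lemma weight_le_one {w : ι → C(S, ℝ≥0)} (hw : ∀ x, ∑ i, w i x = 1) (i : ι) (x : S) :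
    w i x ≤ 1 :=
  (Finset.single_le_sum (f := fun i => w i x) (fun _ _ => zero_le) (Finset.mem_univ i)).trans
    (hw x).le

lemma continuous_lintegral_weight {w : ι → C(S, ℝ≥0)} (hw : ∀ x, ∑ i, w i x = 1) (i : ι) :
    Continuous fun α : RadonProb S => ∫⁻ x, w i x ∂α.toMeasure := by
  have hb : ∀ x y, dist (w i x) (w i y) ≤ 1 := fun x y => by
    rw [NNReal.dist_eq, abs_le]
    have h1 : (w i x : ℝ) ≤ 1 := weight_le_one hw i x
    have h2 : (w i y : ℝ) ≤ 1 := weight_le_one hw i y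
    constructor <;> linarith [(w i x).coe_nonneg, (w i y).coe_nonneg]
  exact (ProbabilityMeasure.continuous_lintegral_boundedContinuousFunction
    (BoundedContinuousFunction.mkOfBound (w i) 1 hb)).comp continuous_subtype_val

lemma continuous_quantize (w : ι → C(S, ℝ≥0)) (hw : ∀ x, ∑ i, w i x = 1) (p : ι → T) :
    Continuous (quantize w hw p) := by
  refine Continuous.subtype_mk ?_ _
  refine ProbabilityMeasure.continuous_iff_forall_continuous_lintegral.2 fun f => ?_
  change Continuous fun α : RadonProb S => ∫⁻ y, f y ∂quantizeMeasure w p α.toMeasure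
  simp_rw [lintegral_quantizeMeasure]
  exact continuous_finsetSum _ fun i _ =>
    ENNReal.continuous_mul_const ENNReal.coe_ne_top |>.comp (continuous_lintegral_weight hw i)

lemma finite_support_quantize (w : ι → C(S, ℝ≥0)) (hw : ∀ x, ∑ i, w i x = 1) (p : ι → T)
    (α : RadonProb S) : (quantize w hw p α).toMeasure.support.Finite := by
  refine (Set.finite_range p).subset
    (Measure.support_subset_of_isClosed (Set.finite_range p).isClosed ?_)
  rw [mem_ae_iff, toMeasure_quantize]
  simp [quantizeMeasure]

/-- The weights of the composition of two quantizations. -/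
noncomputable def compWeight {κ : Type*} (w : ι → C(S, ℝ≥0)) (p : ι → T) (w' : κ → C(T, ℝ≥0))
    (j : κ) : C(S, ℝ≥0) :=
  ∑ i, ContinuousMap.const S (w' j (p i)) * w i

lemma compWeight_apply {κ : Type*} (w : ι → C(S, ℝ≥0)) (p : ι → T) (w' : κ → C(T, ℝ≥0))
    (j : κ) (x : S) : compWeight w p w' j x = ∑ i, w' j (p i) * w i x := by
  simp [compWeight]

lemma sum_compWeight {κ : Type*} [Fintype κ] {w : ι → C(S, ℝ≥0)} (hw : ∀ x, ∑ i, w i x = 1)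
    (p : ι → T) {w' : κ → C(T, ℝ≥0)} (hw' : ∀ x, ∑ i, w' i x = 1) (x : S) :
    ∑ j, compWeight w p w' j x = 1 := by
  simp_rw [compWeight_apply]
  rw [Finset.sum_comm]
  simp_rw [← Finset.sum_mul, hw', one_mul, hw]

/-- Lets a round trip between `X` and `Y` be estimated by one explicit coupling, with no triangle
inequality for `wassersteinInf` and no gluing of couplings. -/
lemma quantize_quantize {κ : Type*} [Fintype κ] {U : Type*} [MetricSpace U] [MeasurableSpace U]
    [BorelSpace U] {w : ι → C(S, ℝ≥0)} (hw : ∀ x, ∑ i, w i x = 1)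
    (p : ι → T) {w' : κ → C(T, ℝ≥0)} (hw' : ∀ x, ∑ i, w' i x = 1) (q : κ → U) (α : RadonProb S) :
    quantize w' hw' q (quantize w hw p α) =
      quantize (compWeight w p w') (sum_compWeight hw p hw') q α := by
  refine RadonProb.ext_toMeasure ?_
  simp only [toMeasure_quantize]
  rw [quantizeMeasure.eq_1 w', quantizeMeasure.eq_1 (compWeight w p w')]
  refine Finset.sum_congr rfl fun j _ => ?_
  congr 1
  rw [lintegral_quantizeMeasure]
  simp_rw [compWeight_apply, ENNReal.ofNNReal_finsetSum, ENNReal.coe_mul]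
  rw [lintegral_finsetSum' _ (fun i _ => by fun_prop)]
  refine Finset.sum_congr rfl fun i _ => ?_
  rw [lintegral_const_mul' _ _ ENNReal.coe_ne_top, mul_comm]

lemma map_quantizeMeasure {U : Type*} [MeasurableSpace U] [MetricSpace U] [BorelSpace U]
    (w : ι → C(S, ℝ≥0)) (p : ι → T)
    (μ : Measure S) {f : T → U} (hf : Measurable f) :
    (quantizeMeasure w p μ).map f = quantizeMeasure w (f ∘ p) μ := by
  simp [quantizeMeasure, Measure.map_finset_sum hf.aemeasurable, Measure.map_smul,
    Measure.map_dirac' hf]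

/-- The convex combination `(1 - t) α + t β`. -/
noncomputable def mix (t : I) (α β : RadonProb S) : RadonProb S :=
  ⟨⟨unitInterval.toNNReal (σ t) • α.toMeasure + unitInterval.toNNReal t • β.toMeasure, ⟨by
    have h := congrArg ((↑) : ℝ≥0 → ℝ≥0∞) (unitInterval.toNNReal_symm_add_toNNReal t)
    rw [Measure.add_apply, Measure.smul_apply, Measure.smul_apply, measure_univ, measure_univ,
      ENNReal.smul_def, ENNReal.smul_def, smul_eq_mul, smul_eq_mul, mul_one, mul_one]
    exact_mod_cast h⟩⟩, by
    change (unitInterval.toNNReal (σ t) • α.toMeasure +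
      unitInterval.toNNReal t • β.toMeasure).InnerRegular
    infer_instance⟩

lemma toMeasure_mix (t : I) (α β : RadonProb S) : (mix t α β).toMeasure =
    unitInterval.toNNReal (σ t) • α.toMeasure + unitInterval.toNNReal t • β.toMeasure := rfl

lemma mix_zero (α β : RadonProb S) : mix 0 α β = α :=
  RadonProb.ext_toMeasure <| by simp [toMeasure_mix]

lemma mix_one (α β : RadonProb S) : mix 1 α β = β :=
  RadonProb.ext_toMeasure <| by simp [toMeasure_mix]

lemma continuous_mix : Continuous fun z : I × RadonProb S × RadonProb S =>
    mix z.1 z.2.1 z.2.2 := by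
  refine Continuous.subtype_mk ?_ _
  refine ProbabilityMeasure.continuous_iff_forall_continuous_integral.2 fun f => ?_
  have hint : ∀ α : RadonProb S, Integrable f α.toMeasure := fun α => f.integrable _
  have h : ∀ z : I × RadonProb S × RadonProb S,
      ∫ x, f x ∂(mix z.1 z.2.1 z.2.2).toMeasure =
        ((σ z.1 : I) : ℝ) * ∫ x, f x ∂z.2.1.toMeasure + (z.1 : ℝ) * ∫ x, f x ∂z.2.2.toMeasure := by
    intro z
    rw [toMeasure_mix, integral_add_measure ((hint _).smul_measure_nnreal)
      ((hint _).smul_measure_nnreal), integral_smul_nnreal_measure, integral_smul_nnreal_measure]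
    rfl
  refine Continuous.congr ?_ fun z => (h z).symm
  have hc : Continuous fun α : RadonProb S => ∫ x, f x ∂α.toMeasure :=
    (ProbabilityMeasure.continuous_integral_boundedContinuousFunction f).comp
      continuous_subtype_val
  exact ((by fun_prop : Continuous fun z : I × RadonProb S × RadonProb S =>
    ((σ z.1 : I) : ℝ)).mul (hc.comp (by fun_prop))).add
    ((by fun_prop : Continuous fun z : I × RadonProb S × RadonProb S =>
    (z.1 : ℝ)).mul (hc.comp (by fun_prop)))

lemma support_mix_subset (t : I) (α β : RadonProb S) :
    (mix t α β).toMeasure.support ⊆ α.toMeasure.support ∪ β.toMeasure.support := by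
  rw [toMeasure_mix, Measure.support_add]
  exact Set.union_subset_union (Measure.AbsolutelyContinuous.support_mono
    (Measure.smul_absolutelyContinuous)) (Measure.AbsolutelyContinuous.support_mono
    (Measure.smul_absolutelyContinuous))

/-- The straight line homotopy from a self-map of `𝒫_S` to the identity. -/
noncomputable def mixHomotopy (f : C(RadonProb S, RadonProb S)) :
    ContinuousMap.Homotopy f (ContinuousMap.id _) where
  toFun z := mix z.1 (f z.2) z.2
  continuous_toFun := continuous_mix.comp (f := fun z : I × RadonProb S => (z.1, f z.2, z.2))
    (by fun_prop)
  map_zero_left α := mix_zero _ _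
  map_one_left α := mix_one _ _

/-- The straight line homotopy from a self-map of `𝒫^fin_S` to the identity. -/
noncomputable def mixHomotopyFin (f : C(FinRadonProb S, FinRadonProb S)) :
    ContinuousMap.Homotopy f (ContinuousMap.id _) where
  toFun z := ⟨mix z.1 (f z.2).1 z.2.1,
    ((f z.2).2.union z.2.2).subset (support_mix_subset _ _ _)⟩
  continuous_toFun := (continuous_mix.comp
    (f := fun z : I × FinRadonProb S => (z.1, (f z.2).1, z.2.1)) (by fun_prop)).subtype_mk _
  map_zero_left α := Subtype.ext (mix_zero _ _)
  map_one_left α := Subtype.ext (mix_one _ _)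

end Quantization

end AmbientCech

namespace AmbientCech

/-! ### Wasserstein estimates for quantization and stability of the homotopy type distance. -/

section Stability

variable {S : Type*} [MetricSpace S] [MeasurableSpace S] [BorelSpace S]
  {ι : Type*} [Fintype ι]

lemma RadonProb.toMeasure_incl (X : Set S) (α : RadonProb X) :
    (α.incl X).toMeasure = α.toMeasure.map Subtype.val := rfl

lemma sum_withDensity_weight {w : ι → C(S, ℝ≥0)} (hw : ∀ x, ∑ i, w i x = 1) (μ : Measure S) :
    ∑ i, μ.withDensity (fun x => w i x) = μ := by
  ext s hs
  have h := sum_lintegral_weight hw μ (s.indicator 1) (measurable_one.indicator hs)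
  rw [lintegral_indicator_one hs] at h
  rw [← h, Measure.finsetSum_apply]
  refine Finset.sum_congr rfl fun i _ => ?_
  rw [withDensity_apply _ hs, ← lintegral_indicator hs]
  refine lintegral_congr fun x => ?_
  by_cases hx : x ∈ s <;> simp [hx]

/-- Open rectangles form a basis, so they suffice to exclude a point from the support. Unlike
general open sets of the product, they are always measurable for the product σ-algebra, even if `M`
is not separable. -/
lemma edist_le_of_mem_support_of_prod {M : Type*} [MetricSpace M] [MeasurableSpace M]
    [BorelSpace M] {π : Measure (M × M)} {r : ℝ≥0∞}
    (h : ∀ u v : Set M, IsOpen u → IsOpen v → (∀ z ∈ u ×ˢ v, r < edist z.1 z.2) →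
      π (u ×ˢ v) = 0) {z : M × M} (hz : z ∈ π.support) : edist z.1 z.2 ≤ r := by
  by_contra! hlt
  have ho : IsOpen {z : M × M | r < edist z.1 z.2} :=
    isOpen_lt continuous_const (continuous_fst.edist continuous_snd)
  obtain ⟨u, v, hu, hv, hzu, hzv, hsub⟩ := isOpen_prod_iff.1 ho z.1 z.2 hlt
  exact Measure.notMem_support_iff_exists.2 ⟨u ×ˢ v,
    (hu.prod hv).mem_nhds ⟨hzu, hzv⟩, h u v hu hv fun y hy => hsub hy⟩ hz

/-- Transporting a part of the mass of `α` along a partition of unity with weights `w i`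
supported in the ball of radius `r` around `p i` costs at most `r`. -/
lemma wassersteinInf_quantizeMeasure_le {X : Set S} (α : RadonProb X) (γ : RadonProb S)
    {w : ι → C(X, ℝ≥0)} (hw : ∀ x, ∑ i, w i x = 1) (p : ι → S) {r : ℝ≥0∞}
    (hr : ∀ i x, w i x ≠ 0 → edist (x : S) (p i) ≤ r) {a b : ℝ≥0} (hab : a + b = 1)
    (hγ : γ.toMeasure = a • quantizeMeasure w p α.toMeasure + b • (α.incl X).toMeasure) :
    wassersteinInf (α.incl X) γ ≤ r := by
  set μ := α.toMeasure
  have hab' : (a : ℝ≥0∞) + b = 1 := by exact_mod_cast hab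
  have md : Measurable fun x : X => ((x : S), (x : S)) := by fun_prop
  have mp : ∀ i, Measurable fun x : X => ((x : S), p i) := fun i => by fun_prop
  -- A fraction `a` is transported to the points `p i`; the fraction `b` stays on the diagonal.
  let π : Measure (S × S) :=
    a • ∑ i, (μ.withDensity fun x => w i x).map (fun x : X => ((x : S), p i)) +
      b • μ.map (fun x : X => ((x : S), (x : S)))
  have hfst : π.map Prod.fst = (α.incl X).toMeasure := by
    have h1 : ∀ i, ((μ.withDensity fun x => w i x).map (fun x : X => ((x : S), p i))).map Prod.fst
        = (μ.withDensity fun x => w i x).map Subtype.val := fun i => by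
      rw [Measure.map_map measurable_fst (mp i)]; rfl
    have h2 : (μ.map (fun x : X => ((x : S), (x : S)))).map Prod.fst = μ.map Subtype.val := by
      rw [Measure.map_map measurable_fst md]; rfl
    simp only [π, Measure.map_add _ _ measurable_fst, Measure.map_smul,
      Measure.map_finset_sum measurable_fst.aemeasurable, h1, h2]
    rw [← Measure.map_finset_sum measurable_subtype_coe.aemeasurable, sum_withDensity_weight hw,
      ← add_smul, hab, one_smul, RadonProb.toMeasure_incl]
  have hsnd : π.map Prod.snd = γ.toMeasure := by
    have h1 : ∀ i, ((μ.withDensity fun x => w i x).map (fun x : X => ((x : S), p i))).map Prod.snd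
        = (∫⁻ x, w i x ∂μ) • Measure.dirac (p i) := fun i => by
      rw [Measure.map_map measurable_snd (mp i)]
      change (μ.withDensity fun x => w i x).map (fun _ => p i) = _
      rw [Measure.map_const, withDensity_apply _ MeasurableSet.univ, Measure.restrict_univ]
    have h2 : (μ.map (fun x : X => ((x : S), (x : S)))).map Prod.snd = μ.map Subtype.val := by
      rw [Measure.map_map measurable_snd md]; rfl
    simp only [π, Measure.map_add _ _ measurable_snd, Measure.map_smul,
      Measure.map_finset_sum measurable_snd.aemeasurable, h1, h2]
    rw [hγ, RadonProb.toMeasure_incl, quantizeMeasure]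
  have hπ : IsProbabilityMeasure π := by
    have : IsProbabilityMeasure (π.map Prod.fst) := hfst ▸ inferInstance
    exact Measure.isProbabilityMeasure_of_map (μ := π) Prod.fst
  refine iInf₂_le_of_le π ⟨hπ, hfst, hsnd⟩ (iSup₂_le fun z hz => ?_)
  refine edist_le_of_mem_support_of_prod (fun u v hu hv huv => ?_) hz
  have hm : MeasurableSet (u ×ˢ v) := hu.measurableSet.prod hv.measurableSet
  have h1 : ∀ i, (μ.withDensity fun x => w i x).map (fun x : X => ((x : S), p i)) (u ×ˢ v) = 0 := by
    intro i
    rw [Measure.map_apply (mp i) hm, withDensity_apply _ (mp i hm)]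
    refine (setLIntegral_congr_fun (mp i hm) fun x hx => ?_).trans lintegral_zero
    by_contra hne
    -- Where `w i` is nonzero, `x` is within `r` of `p i`, so the density vanishes on the preimage
    -- of the rectangle.
    exact (huv _ hx).not_ge (hr i x (by simpa using hne))
  have h2 : μ.map (fun x : X => ((x : S), (x : S))) (u ×ˢ v) = 0 := by
    rw [Measure.map_apply md hm]
    convert measure_empty (μ := μ)
    ext x
    simp only [Set.mem_preimage, Set.mem_empty_iff_false, iff_false]
    intro hx
    simpa using huv _ hx
  simp [π, h1, h2]

lemma support_incl_subset (X : Set S) (α : RadonProb X) :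
    (α.incl X).toMeasure.support ⊆ closure X := by
  refine Measure.support_subset_of_isClosed isClosed_closure ?_
  rw [mem_ae_iff, RadonProb.toMeasure_incl,
    Measure.map_apply measurable_subtype_coe isClosed_closure.measurableSet.compl]
  convert measure_empty (μ := α.toMeasure)
  ext x
  simpa using subset_closure x.2

lemma isBounded_support_incl {X : Set S} (hX : TotallyBounded X) (α : RadonProb X) :
    Bornology.IsBounded (α.incl X).toMeasure.support :=
  hX.isBounded.closure.subset (support_incl_subset X α)

lemma LipschitzWassersteinInf.le_add {C : ℝ≥0} {𝔦 : RadonProb S → ℝ}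
    (h𝔦 : LipschitzWassersteinInf C 𝔦) {X Y : Set S} (hX : TotallyBounded X)
    (hY : TotallyBounded Y) (α : RadonProb X) (β : RadonProb Y) {r : ℝ≥0}
    (h : wassersteinInf (α.incl X) (β.incl Y) ≤ r) :
    restr Y 𝔦 β ≤ restr X 𝔦 α + (C * r : ℝ≥0) := by
  have h1 := (h𝔦 _ _ (isBounded_support_incl hX α) (isBounded_support_incl hY β)).trans
    (mul_le_mul_right h _)
  rw [← ENNReal.coe_mul, edist_le_coe, ← NNReal.coe_le_coe, coe_nndist, Real.dist_eq] at h1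
  have h2 := (abs_le.1 h1).1
  change 𝔦 (β.incl Y) ≤ 𝔦 (α.incl X) + _
  linarith

lemma LipschitzWassersteinInf.quantize_le {C : ℝ≥0} {𝔦 : RadonProb S → ℝ}
    (h𝔦 : LipschitzWassersteinInf C 𝔦) {X Y : Set S} (hX : TotallyBounded X)
    (hY : TotallyBounded Y) {w : ι → C(X, ℝ≥0)} (hw : ∀ x, ∑ i, w i x = 1) (p : ι → Y) {r : ℝ≥0}
    (hr : ∀ i x, w i x ≠ 0 → edist (x : S) (p i : S) ≤ r) (α : RadonProb X) :
    restr Y 𝔦 (quantize w hw p α) ≤ restr X 𝔦 α + (C * r : ℝ≥0) := by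
  refine h𝔦.le_add hX hY _ _ (wassersteinInf_quantizeMeasure_le α _ hw
    (Subtype.val ∘ p) (fun i x h => hr i x h) (add_zero 1) ?_)
  rw [RadonProb.toMeasure_incl, toMeasure_quantize, map_quantizeMeasure _ _ _ measurable_subtype_coe]
  simp

lemma LipschitzWassersteinInf.mix_quantize_le {C : ℝ≥0} {𝔦 : RadonProb S → ℝ}
    (h𝔦 : LipschitzWassersteinInf C 𝔦) {X : Set S} (hX : TotallyBounded X)
    {w : ι → C(X, ℝ≥0)} (hw : ∀ x, ∑ i, w i x = 1) (p : ι → X) {r : ℝ≥0}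
    (hr : ∀ i x, w i x ≠ 0 → edist (x : S) (p i : S) ≤ r) (t : I) (α : RadonProb X) :
    restr X 𝔦 (mix t (quantize w hw p α) α) ≤ restr X 𝔦 α + (C * r : ℝ≥0) := by
  refine h𝔦.le_add hX hX _ _ (wassersteinInf_quantizeMeasure_le α _ hw
    (Subtype.val ∘ p) (fun i x h => hr i x h) (unitInterval.toNNReal_symm_add_toNNReal t) ?_)
  rw [RadonProb.toMeasure_incl, RadonProb.toMeasure_incl, toMeasure_mix,
    Measure.map_add _ _ measurable_subtype_coe, Measure.map_smul, Measure.map_smul,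
    toMeasure_quantize, map_quantizeMeasure _ _ _ measurable_subtype_coe]

/-- A totally bounded set at Hausdorff distance less than `δ` from `Y` carries a finite partition
of unity subordinate to a cover by `δ`-balls around points of `Y`. -/
lemma exists_weights {X Y : Set S} (hX : TotallyBounded X) {δ : ℝ≥0}
    (h : Metric.hausdorffEDist X Y < δ) :
    ∃ (s : Finset S) (w : s → C(X, ℝ≥0)) (p : s → Y), (∀ x, ∑ i, w i x = 1) ∧
      ∀ i x, w i x ≠ 0 → edist (x : S) (p i : S) ≤ δ := by
  -- Split `δ`: an error `δ - δ'` for the finite net in `X`, and `δ'` for moving net points into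
  -- `Y`.
  obtain ⟨δ', h1, h2⟩ := ENNReal.lt_iff_exists_nnreal_btwn.1 h
  obtain ⟨t, htX, htf, hcov⟩ := EMetric.totallyBounded_iff'.1 hX (δ - δ') (tsub_pos_of_lt h2)
  choose q hqY hq using fun x (hx : x ∈ X) => Metric.exists_edist_lt_of_hausdorffEDist_lt hx h1
  let s := htf.toFinset
  have hs : ∀ i : s, (i : S) ∈ X := fun i => htX (htf.mem_toFinset.1 i.2)
  let p : s → Y := fun i => ⟨q i (hs i), hqY i (hs i)⟩
  -- Truncated subtraction makes this a tent function vanishing outside the `δ`-ball around `p i`.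
  let φ : s → X → ℝ≥0 := fun i x => δ - nndist (x : S) (p i)
  have hφ : ∀ i, Continuous (φ i) := fun i => by fun_prop
  have hpos : ∀ x, ∑ i, φ i x ≠ 0 := by
    intro x
    obtain ⟨y, hy, hxy⟩ := Set.mem_iUnion₂.1 (hcov x.2)
    let i : s := ⟨y, htf.mem_toFinset.2 hy⟩
    have hlt : edist (x : S) (p i) < δ := by
      calc edist (x : S) (p i) ≤ edist (x : S) y + edist y (p i) := edist_triangle _ _ _
        _ < (δ - δ') + δ' := ENNReal.add_lt_add hxy (hq y (hs i))
        _ = δ := tsub_add_cancel_of_le h2.le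
    intro h0
    have := (Finset.sum_eq_zero_iff.1 h0) i (Finset.mem_univ _)
    rw [edist_nndist, ENNReal.coe_lt_coe] at hlt
    exact (tsub_pos_of_lt hlt).ne' this
  refine ⟨s, fun i => ⟨fun x => φ i x / ∑ j, φ j x,
    (hφ i).div₀ (continuous_finsetSum _ fun j _ => hφ j) hpos⟩, p, fun x => ?_, fun i x hne => ?_⟩
  · simp only [ContinuousMap.coe_mk]
    rw [← Finset.sum_div, div_self (hpos x)]
  · by_contra! hlt
    rw [edist_nndist, ENNReal.coe_lt_coe] at hlt
    refine hne ?_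
    simp only [ContinuousMap.coe_mk, φ, tsub_eq_zero_of_le hlt.le, zero_div]

/-- A nonzero composite weight has a nonzero summand, whose point `p i` is within `r` of both `x`
and `q j`. -/
lemma compWeight_ne_zero {X Y Z : Set S} {κ : Type*} {w : ι → C(X, ℝ≥0)} {p : ι → Y}
    {w' : κ → C(Y, ℝ≥0)} {q : κ → Z} {r : ℝ≥0}
    (hr : ∀ i x, w i x ≠ 0 → edist (x : S) (p i : S) ≤ r)
    (hr' : ∀ i x, w' i x ≠ 0 → edist (x : S) (q i : S) ≤ r) (j : κ) (x : X)
    (h : compWeight w p w' j x ≠ 0) : edist (x : S) (q j : S) ≤ (2 * r : ℝ≥0) := by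
  rw [compWeight_apply] at h
  obtain ⟨i, -, hi⟩ := Finset.exists_ne_zero_of_sum_ne_zero h
  refine (edist_triangle _ (p i : S) _).trans ?_
  rw [two_mul, ENNReal.coe_add]
  exact add_le_add (hr i x (right_ne_zero_of_mul hi)) (hr' j _ (left_ne_zero_of_mul hi))

variable {X Y : Set S} {C : ℝ≥0} {𝔦 : RadonProb S → ℝ}

lemma LipschitzWassersteinInf.mix_quantize_quantize_le (h𝔦 : LipschitzWassersteinInf C 𝔦)
    (hX : TotallyBounded X) {κ : Type*} [Fintype κ] {w : ι → C(X, ℝ≥0)} {p : ι → Y}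
    {w' : κ → C(Y, ℝ≥0)} {q : κ → X} {r : ℝ≥0}
    (hw : ∀ x, ∑ i, w i x = 1) (hw' : ∀ x, ∑ i, w' i x = 1)
    (hr : ∀ i x, w i x ≠ 0 → edist (x : S) (p i : S) ≤ r)
    (hr' : ∀ i x, w' i x ≠ 0 → edist (x : S) (q i : S) ≤ r) (t : I) (α : RadonProb X) :
    restr X 𝔦 (mix t (quantize w' hw' q (quantize w hw p α)) α) ≤
      restr X 𝔦 α + (2 * (C * r) : ℝ≥0) := by
  rw [quantize_quantize, mul_left_comm]
  exact h𝔦.mix_quantize_le hX _ q (compWeight_ne_zero hr hr') t α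

lemma LipschitzWassersteinInf.deltaHomotopyEquivalent (h𝔦 : LipschitzWassersteinInf C 𝔦)
    (hX : TotallyBounded X) (hY : TotallyBounded Y) {δ : ℝ≥0}
    (h : Metric.hausdorffEDist X Y < δ) :
    DeltaHomotopyEquivalent (restr X 𝔦) (restr Y 𝔦) (C * δ) ∧
      DeltaHomotopyEquivalent (restrFin X 𝔦) (restrFin Y 𝔦) (C * δ) := by
  obtain ⟨s, w, p, hw, hr⟩ := exists_weights hX h
  obtain ⟨s', w', q, hw', hr'⟩ := exists_weights hY (Metric.hausdorffEDist_comm.trans_lt h)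
  constructor
  · exact ⟨⟨_, continuous_quantize w hw p⟩, ⟨_, continuous_quantize w' hw' q⟩,
      h𝔦.quantize_le hX hY hw p hr, h𝔦.quantize_le hY hX hw' q hr',
      ⟨mixHomotopy _, h𝔦.mix_quantize_quantize_le hX hw hw' hr hr'⟩,
      ⟨mixHomotopy _, h𝔦.mix_quantize_quantize_le hY hw' hw hr' hr⟩⟩
  · exact ⟨⟨fun α => ⟨quantize w hw p α.1, finite_support_quantize _ _ _ _⟩,
        ((continuous_quantize w hw p).comp continuous_subtype_val).subtype_mk _⟩,
      ⟨fun α => ⟨quantize w' hw' q α.1, finite_support_quantize _ _ _ _⟩,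
        ((continuous_quantize w' hw' q).comp continuous_subtype_val).subtype_mk _⟩,
      fun α => h𝔦.quantize_le hX hY hw p hr α.1, fun α => h𝔦.quantize_le hY hX hw' q hr' α.1,
      ⟨mixHomotopyFin _, fun t α => h𝔦.mix_quantize_quantize_le hX hw hw' hr hr' t α.1⟩,
      ⟨mixHomotopyFin _, fun t α => h𝔦.mix_quantize_quantize_le hY hw' hw hr' hr t α.1⟩⟩

lemma LipschitzWassersteinInf.dHT_le (h𝔦 : LipschitzWassersteinInf C 𝔦) (hC : 0 < C)
    (hX : TotallyBounded X) (hY : TotallyBounded Y) :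
    dHT (restr X 𝔦) (restr Y 𝔦) ≤ C * Metric.hausdorffEDist X Y ∧
      dHT (restrFin X 𝔦) (restrFin Y 𝔦) ≤ C * Metric.hausdorffEDist X Y := by
  have hC0 : (C : ℝ≥0∞) ≠ 0 := by exact_mod_cast hC.ne'
  have key : ∀ d : ℝ≥0∞, (∀ δ : ℝ≥0, Metric.hausdorffEDist X Y < δ → d ≤ (C * δ : ℝ≥0)) →
      d ≤ C * Metric.hausdorffEDist X Y := by
    intro d hd
    -- Positivity of `C` matters here: for `C = 0` and infinite Hausdorff distance the right side
    -- would be `0 * ∞ = 0`.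
    rw [mul_comm, ← ENNReal.div_le_iff_le_mul (.inl hC0) (.inl ENNReal.coe_ne_top)]
    refine le_of_forall_gt fun a ha => ?_
    obtain ⟨δ, h1, h2⟩ := ENNReal.lt_iff_exists_nnreal_btwn.1 ha
    refine lt_of_le_of_lt ?_ h2
    rw [ENNReal.div_le_iff_le_mul (.inl hC0) (.inl ENNReal.coe_ne_top), mul_comm]
    exact (hd δ h1).trans_eq (ENNReal.coe_mul _ _)
  exact ⟨key _ fun δ h => iInf₂_le _ (h𝔦.deltaHomotopyEquivalent hX hY h).1,
    key _ fun δ h => iInf₂_le _ (h𝔦.deltaHomotopyEquivalent hX hY h).2⟩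

end Stability

end AmbientCech

namespace AmbientCech

/-! ### From homotopy equivalences to interleavings in homology. -/

section Interleaving

universe u v

/-- The map induced by a `δ`-map on sublevel sets. -/
def IsDeltaMap.sublevelMap {A B : Type*} [TopologicalSpace A] [TopologicalSpace B] {φ : A → ℝ}
    {ψ : B → ℝ} {δ : ℝ≥0} {Φ : C(A, B)} (h : IsDeltaMap φ ψ δ Φ) {r s : ℝ} (hrs : r + δ ≤ s) :
    C({x : A // φ x < r}, {y : B // ψ y < s}) where
  toFun x := ⟨Φ x.1, by linarith [h x.1, x.2]⟩
  continuous_toFun := by fun_prop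

variable {A B : Type u} [TopologicalSpace A] [TopologicalSpace B] {φ : A → ℝ} {ψ : B → ℝ}
  {δ : ℝ≥0}

lemma singularHomology_map_eq_of_homotopy (F : Type v) [Field F] (n : ℕ) {X Y : TopCat.{u}}
    {f g : X ⟶ Y} (H : TopCat.Homotopy f g) :
    (singularHomology F n).map f = (singularHomology F n).map g :=
  H.congr_homologyMap_singularChainComplexFunctor _ n

/-- The transformation of persistent homology modules induced by a `δ`-map. -/
noncomputable def IsDeltaMap.homologyTrans {Φ : C(A, B)} (h : IsDeltaMap φ ψ δ Φ) (F : Type v)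
    [Field F] (n : ℕ) :
    sublevel φ ⋙ singularHomology.{u} F n ⟶
      shift δ ⋙ sublevel ψ ⋙ singularHomology.{u} F n where
  app t := (singularHomology F n).map (TopCat.ofHom (h.sublevelMap le_rfl))
  naturality s t hst := by
    exact ((singularHomology F n).map_comp _ _).symm.trans ((singularHomology F n).map_comp
      (TopCat.ofHom (h.sublevelMap le_rfl)) ((sublevel ψ).map ((shift δ).map hst)))

/-- On `φ < t` the `2δ`-homotopy stays inside `φ < t + 2δ`, so it connects the composite to the
inclusion there, and both induce the same map on homology. -/
lemma IsDeltaMap.homologyTrans_comp {Φ : C(A, B)} {Ψ : C(B, A)} (h : IsDeltaMap φ ψ δ Φ)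
    (h' : IsDeltaMap ψ φ δ Ψ)
    (H : DeltaHomotopic φ φ (2 * δ) (Ψ.comp Φ) (ContinuousMap.id A)) (F : Type v)
    [Field F] (n : ℕ) (t u : ℝ) (hu : u = t + δ + δ) (htu : t ≤ u) :
    (singularHomology.{u} F n).map (TopCat.ofHom (h.sublevelMap (le_refl (t + δ)))) ≫
      (singularHomology F n).map (TopCat.ofHom (h'.sublevelMap hu.ge)) =
    (sublevel φ ⋙ singularHomology F n).map (homOfLE htu) := by
  obtain ⟨H, hH⟩ := H
  rw [← Functor.map_comp, Functor.comp_map]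
  refine singularHomology_map_eq_of_homotopy F n (?_ : ContinuousMap.Homotopy _ _)
  refine
    { toFun := fun z => ⟨H (z.1, z.2.1), ?_⟩
      continuous_toFun := ?_
      map_zero_left := fun x => ?_
      map_one_left := fun x => ?_ }
  · have h1 := hH z.1 z.2.1
    have h2 : φ z.2.1 < t := z.2.2
    push_cast at h1
    linarith
  · exact (H.continuous.comp (by fun_prop)).subtype_mk _
  · exact Subtype.ext (H.apply_zero _)
  · exact Subtype.ext (H.apply_one _)

lemma DeltaHomotopyEquivalent.interleaved (h : DeltaHomotopyEquivalent φ ψ δ) (F : Type v)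
    [Field F] (n : ℕ) :
    Interleaved (sublevel φ ⋙ singularHomology.{u} F n) (sublevel ψ ⋙ singularHomology.{u} F n)
      δ := by
  obtain ⟨Φ, Ψ, hΦ, hΨ, H, H'⟩ := h
  exact ⟨hΦ.homologyTrans F n, hΨ.homologyTrans F n,
    fun t => hΦ.homologyTrans_comp hΨ H F n t _ rfl _,
    fun t => hΨ.homologyTrans_comp hΦ H' F n t _ rfl _⟩

lemma dI_singularHomology_le_dHT (φ : A → ℝ) (ψ : B → ℝ) (F : Type v) [Field F] (n : ℕ) :
    dI (sublevel φ ⋙ singularHomology.{u} F n) (sublevel ψ ⋙ singularHomology.{u} F n)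
      ≤ dHT φ ψ :=
  le_iInf₂ fun δ h => iInf₂_le δ (h.interleaved F n)

end Interleaving

end AmbientCech

namespace AmbientCech

/-! ### Lipschitz continuity of the `p`-radius. -/

section Radius

variable {S : Type*} [MetricSpace S] [MeasurableSpace S] [BorelSpace S]

lemma RadonProb.support_mem_ae (α : RadonProb S) : α.toMeasure.support ∈ ae α.toMeasure :=
  Measure.support_mem_ae_of_innerRegular

lemma RadonProb.nonempty_support (α : RadonProb S) : α.toMeasure.support.Nonempty :=
  Filter.nonempty_of_mem α.support_mem_ae

lemma RadonProb.exists_isCompact_compl_le (α : RadonProb S) {ε : ℝ≥0∞} (hε : ε ≠ 0) :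
    ∃ K, IsCompact K ∧ α.toMeasure Kᶜ ≤ ε := by
  obtain ⟨K, -, hK, h⟩ := MeasurableSet.exists_isCompact_sdiff_lt (μ := α.toMeasure)
    MeasurableSet.univ (measure_ne_top _ _) hε
  exact ⟨K, hK, by rw [Set.compl_eq_univ_sdiff]; exact h.le⟩

/-- The support of a coupling of Radon measures has full measure. -/
lemma IsCoupling.support_mem_ae {α β : RadonProb S} {π : Measure (S × S)}
    (h : IsCoupling α β π) : π.support ∈ ae π := by
  rw [mem_ae_iff]
  -- `π` is not assumed Radon, but its marginals are tight. Writing the open complement of the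
  -- support as a countable union of closed sets makes each `F n ∩ K ×ˢ L` compact, hence null.
  obtain ⟨F, hF, hFsub, hFU, -⟩ :=
    (Measure.isOpen_compl_support (μ := π)).exists_iUnion_isClosed
  refine le_antisymm (ENNReal.le_of_forall_pos_le_add fun ε hε _ => ?_) zero_le
  have hε' : (ε : ℝ≥0∞) / 2 ≠ 0 := by simpa using hε.ne'
  obtain ⟨K, hK, hKα⟩ := α.exists_isCompact_compl_le hε'
  obtain ⟨L, hL, hLβ⟩ := β.exists_isCompact_compl_le hε'
  have h0 : π (⋃ n, F n ∩ K ×ˢ L) = 0 := by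
    refine measure_iUnion_null fun n => Measure.measure_eq_zero_of_isCompact_subset_compl_support
      ((hK.prod hL).inter_left (hF n)) (Set.inter_subset_left.trans (hFsub n))
  have hsub : π.supportᶜ ⊆ (⋃ n, F n ∩ K ×ˢ L) ∪ (Prod.fst ⁻¹' Kᶜ ∪ Prod.snd ⁻¹' Lᶜ) := by
    rw [← hFU, ← Set.iUnion_inter]
    intro z hz
    by_cases h1 : z.1 ∈ K <;> by_cases h2 : z.2 ∈ L <;> simp_all
  have h1 : π (Prod.fst ⁻¹' Kᶜ) ≤ ε / 2 := by
    rwa [← Measure.map_apply measurable_fst hK.measurableSet.compl, h.2.1]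
  have h2 : π (Prod.snd ⁻¹' Lᶜ) ≤ ε / 2 := by
    rwa [← Measure.map_apply measurable_snd hL.measurableSet.compl, h.2.2]
  calc π π.supportᶜ ≤ π (⋃ n, F n ∩ K ×ˢ L) + (π (Prod.fst ⁻¹' Kᶜ) + π (Prod.snd ⁻¹' Lᶜ)) :=
        (measure_mono hsub).trans ((measure_union_le _ _).trans
          (add_le_add le_rfl (measure_union_le _ _)))
    _ ≤ 0 + (ε / 2 + ε / 2) := by rw [h0]; gcongr
    _ = 0 + ε := by rw [ENNReal.add_halves]

lemma IsCoupling.ae_edist_le {α β : RadonProb S} {π : Measure (S × S)} (h : IsCoupling α β π) :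
    ∀ᵐ z ∂π, edist z.1 z.2 ≤ ⨆ z ∈ π.support, edist z.1 z.2 := by
  filter_upwards [h.support_mem_ae] with z hz
  exact le_iSup₂ (f := fun (z : S × S) (_ : z ∈ π.support) => edist z.1 z.2) z hz

/-- For `p < ∞` this is Minkowski's inequality in `L^p(π)` applied to `d(z.1, m) ≤ d(z.2, m) + D`.
For `p = ∞`, points of the support of `α` are approximated by first coordinates of `π`-generic
points. -/
lemma frechet_le_add_of_coupling {p : ℝ≥0∞} (hp : 1 ≤ p) {α β : RadonProb S}
    {π : Measure (S × S)} (h : IsCoupling α β π) {D : ℝ≥0∞} (hD : ∀ᵐ z ∂π, edist z.1 z.2 ≤ D)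
    (m : S) : frechet p α m ≤ frechet p β m + D := by
  have := h.1
  unfold frechet
  split_ifs with hpt
  · refine iSup₂_le fun x hx => ENNReal.le_of_forall_pos_le_add fun ε hε _ => ?_
    have h1 : 0 < π (Prod.fst ⁻¹' Metric.eball x ε) := by
      rw [← Measure.map_apply measurable_fst Metric.isOpen_eball.measurableSet, h.2.1]
      exact (Measure.mem_support_iff_forall x).1 hx _ (Metric.eball_mem_nhds x (by simpa using hε))
    have h2 : ∀ᵐ z ∂π, z.2 ∈ β.toMeasure.support := by
      have := β.support_mem_ae
      rw [← h.2.2] at this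
      exact ae_of_ae_map measurable_snd.aemeasurable (h.2.2 ▸ this)
    have h3 : ∃ᶠ z in ae π, z ∈ Prod.fst ⁻¹' Metric.eball x ε := frequently_ae_iff.2 h1.ne'
    -- The ball around `x` has positive mass, so it meets the full-measure conditions on `z`.
    obtain ⟨z, hz1, hz2, hz3⟩ := (h3.and_eventually (hD.and h2)).exists
    calc edist x m ≤ edist x z.1 + edist z.1 z.2 + edist z.2 m := edist_triangle4 _ _ _ _
      _ ≤ ε + D + ⨆ z ∈ β.toMeasure.support, edist z m := by
        gcongr
        · rw [edist_comm]; exact le_of_lt hz1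
        · exact le_iSup₂ (f := fun z (_ : z ∈ β.toMeasure.support) => edist z m) z.2 hz3
      _ = (⨆ z ∈ β.toMeasure.support, edist z m) + D + ε := by ring
  · have hp1 : 1 ≤ p.toReal := by
      simpa using ENNReal.toReal_mono hpt hp
    have hm : Measurable fun z : S => edist z m := (continuous_id.edist continuous_const).measurable
    rw [← h.2.1, ← h.2.2, lintegral_map (hm.pow_const _) measurable_fst,
      lintegral_map (hm.pow_const _) measurable_snd]
    calc (∫⁻ z, edist z.1 m ^ p.toReal ∂π) ^ (1 / p.toReal)
        ≤ (∫⁻ z, ((fun z : S × S => edist z.2 m) + (fun _ => D : S × S → ℝ≥0∞)) z ^ p.toReal ∂π)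
            ^ (1 / p.toReal) := by
          refine ENNReal.rpow_le_rpow (lintegral_mono_ae ?_) (by positivity)
          filter_upwards [hD] with z hz
          refine ENNReal.rpow_le_rpow ?_ (by positivity)
          rw [Pi.add_apply, add_comm]
          exact (edist_triangle _ z.2 _).trans (add_le_add hz le_rfl)
      _ ≤ (∫⁻ z, edist z.2 m ^ p.toReal ∂π) ^ (1 / p.toReal)
            + (∫⁻ _, D ^ p.toReal ∂π) ^ (1 / p.toReal) :=
          ENNReal.lintegral_Lp_add_le (hm.comp measurable_snd).aemeasurable
            aemeasurable_const hp1
      _ = (∫⁻ z, edist z.2 m ^ p.toReal ∂π) ^ (1 / p.toReal) + D := by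
          rw [lintegral_const, measure_univ, mul_one, ← ENNReal.rpow_mul,
            mul_one_div_cancel (by positivity), ENNReal.rpow_one]

lemma IsCoupling.symm {α β : RadonProb S} {π : Measure (S × S)} (h : IsCoupling α β π) :
    IsCoupling β α (π.map Prod.swap) := by
  have := h.1
  refine ⟨Measure.isProbabilityMeasure_map measurable_swap.aemeasurable, ?_, ?_⟩
  · rw [Measure.map_map measurable_fst measurable_swap]; exact h.2.2
  · rw [Measure.map_map measurable_snd measurable_swap]; exact h.2.1

/-- With `m` in the support, the diameter of the support bounds the Fréchet function. This makes
`toReal` in `radius` harmless. -/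
lemma iInf_frechet_ne_top {p : ℝ≥0∞} {α : RadonProb S}
    (h : Bornology.IsBounded α.toMeasure.support) : ⨅ m : S, frechet p α m ≠ ∞ := by
  obtain ⟨m, hm⟩ := α.nonempty_support
  have hd : Metric.ediam α.toMeasure.support ≠ ∞ := h.ediam_ne_top
  have hle : ∀ z ∈ α.toMeasure.support, edist z m ≤ Metric.ediam α.toMeasure.support :=
    fun z hz => Metric.edist_le_ediam_of_mem hz hm
  refine ne_top_of_le_ne_top ?_ (iInf_le _ m)
  unfold frechet
  split_ifs with hpt
  · exact ne_top_of_le_ne_top hd (iSup₂_le hle)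
  · refine ENNReal.rpow_ne_top_of_nonneg (by positivity) ?_
    refine ne_top_of_le_ne_top
      (ENNReal.rpow_ne_top_of_nonneg p.toReal_nonneg hd) ?_
    calc ∫⁻ z, edist z m ^ p.toReal ∂α.toMeasure
        ≤ ∫⁻ _, Metric.ediam α.toMeasure.support ^ p.toReal ∂α.toMeasure := by
          refine lintegral_mono_ae ?_
          filter_upwards [α.support_mem_ae] with z hz
          exact ENNReal.rpow_le_rpow (hle z hz) p.toReal_nonneg
      _ = _ := by simp

lemma lipschitzWassersteinInf_radius {p : ℝ≥0∞} (hp : 1 ≤ p) :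
    LipschitzWassersteinInf 1 (radius p : RadonProb S → ℝ) := by
  intro α β hα hβ
  rw [ENNReal.coe_one, one_mul]
  refine le_iInf₂ fun π h => ?_
  set D := ⨆ z ∈ π.support, edist z.1 z.2
  rcases eq_or_ne D ∞ with hD | hD
  · simp [hD]
  -- `D` stays fixed while the coupling varies, so the swapped coupling serves for the reverse
  -- inequality without computing its own supremum.
  have key : ∀ {α β : RadonProb S} {π : Measure (S × S)}, IsCoupling α β π →
      Bornology.IsBounded β.toMeasure.support →
      (∀ᵐ z ∂π, edist z.1 z.2 ≤ D) → radius p α ≤ radius p β + D.toReal := by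
    intro α β π h hβ hπ
    rw [radius, radius, ← ENNReal.toReal_add (iInf_frechet_ne_top hβ) hD]
    refine ENNReal.toReal_mono (ENNReal.add_ne_top.2 ⟨iInf_frechet_ne_top hβ, hD⟩) ?_
    rw [ENNReal.iInf_add]
    exact iInf_mono fun m => frechet_le_add_of_coupling hp h hπ m
  have h1 := key h hβ h.ae_edist_le
  have h2 := key h.symm hα 
    ((MeasurableEquiv.prodComm.measurableEmbedding.ae_map_iff (μ := π)).2 <| by
      filter_upwards [h.ae_edist_le] with z hz
      exact (edist_comm _ _).trans_le hz)
  rw [edist_dist, Real.dist_eq]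
  refine ENNReal.ofReal_le_of_le_toReal (abs_le.2 ⟨by linarith, by linarith⟩)

end Radius

end AmbientCech

theorem theoremA15 {M : Type*} [MetricSpace M] [MeasurableSpace M] [BorelSpace M]
    (X Y : Set M) (hX : TotallyBounded X) (hY : TotallyBounded Y) :
    (∀ (C : ℝ≥0) (𝔦 : RadonProb M → ℝ), 0 < C → LipschitzWassersteinInf C 𝔦 →
      dHT (restr X 𝔦) (restr Y 𝔦) ≤ C * Metric.hausdorffEDist X Y ∧
      dHT (restrFin X 𝔦) (restrFin Y 𝔦) ≤ C * Metric.hausdorffEDist X Y) ∧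
    (∀ (p : ℝ≥0∞), 1 ≤ p → ∀ (F : Type*) [Field F] (n : ℕ),
      (dI (ambientCech p X ⋙ singularHomology F n) (ambientCech p Y ⋙ singularHomology F n)
          ≤ dHT (restr X (radius p)) (restr Y (radius p)) ∧
        dHT (restr X (radius p)) (restr Y (radius p)) ≤ Metric.hausdorffEDist X Y) ∧
      (dI (ambientCechFin p X ⋙ singularHomology F n)
            (ambientCechFin p Y ⋙ singularHomology F n)
          ≤ dHT (restrFin X (radius p)) (restrFin Y (radius p)) ∧
        dHT (restrFin X (radius p)) (restrFin Y (radius p)) ≤ Metric.hausdorffEDist X Y)) := by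
  refine ⟨fun C 𝔦 hC h𝔦 => h𝔦.dHT_le hC hX hY, fun p hp F _ n => ?_⟩
  have h := (lipschitzWassersteinInf_radius (S := M) hp).dHT_le one_pos hX hY
  rw [ENNReal.coe_one, one_mul] at h
  exact ⟨⟨dI_singularHomology_le_dHT _ _ F n, h.1⟩, dI_singularHomology_le_dHT _ _ F n, h.2⟩
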